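/- Let $G$ be a connected simple undirected graph with $n\ge 2$ vertices, $m$ edges and $\tau$ spanning trees, and let $Z_1=\sum_{v}d(v)^2$ be its first Zagreb index, where $d(v)$ is the degree of the vertex $v$. Let $\mu_1\ge\mu_2\ge\cdots\ge\mu_{n-1}\ge\mu_n=0$ be the eigenvalues, counted with multiplicity, of the Laplacian matrix $L(G)=D(G)-A(G)$ (degree matrix minus adjacency matrix), and let $R_L(G)=\mu_1/\mu_{n-1}$ be the Laplacian spectral ratio of $G$. Then for every real number $\alpha$ with $\mu_{n-1}\le n\alpha\le\mu_1$, $$R_L(G)\le 1+\frac{\sqrt{2\Omega}\,\Bigl(2m+n\alpha+\sqrt{\tfrac{\Omega}{n-1}}\Bigr)^{n-1}}{n^{\,n+3/2}\,\alpha\,\tau},$$ where $\Omega=n^2(n-1)\alpha^2-4mn\alpha+nZ_1+2mn-4m^2$. -/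

import Mathlib

namespace SimpleGraph

/-- The Laplacian eigenvalue `μ_k(G)`, `1 ≤ k ≤ n`, where `μ₁ ≥ μ₂ ≥ ⋯ ≥ μ_n` are the eigenvalues
of `L(G) = D(G) - A(G)` counted with multiplicity (`n` is the number of vertices).
Outside the range `1 ≤ k ≤ n` the value is `0` by convention. -/
noncomputable def lapEigenvalue {V : Type*} [Fintype V] [DecidableEq V] (G : SimpleGraph V)
    [DecidableRel G.Adj] (k : ℕ) : ℝ :=
  if h : 1 ≤ k ∧ k ≤ Fintype.card V then
    (G.isHermitian_lapMatrix (R := ℝ)).eigenvalues₀ ⟨k - 1, by omega⟩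
  else 0

/-- The Laplacian spectral ratio `R_L(G) = μ₁(G) / μ_{n-1}(G)`: the quotient of the largest and
the second smallest Laplacian eigenvalue. -/
noncomputable def lapSpectralRatio {V : Type*} [Fintype V] [DecidableEq V] (G : SimpleGraph V)
    [DecidableRel G.Adj] : ℝ :=
  G.lapEigenvalue 1 / G.lapEigenvalue (Fintype.card V - 1)

/-- The first Zagreb index: the sum of the squares of the vertex degrees. -/
def firstZagreb {V : Type*} [Fintype V] (G : SimpleGraph V) [DecidableRel G.Adj] : ℕ :=
  ∑ v, G.degree v ^ 2

/-- The number of spanning trees of `G`: trees on the whole vertex set all of whose edges are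
edges of `G`. -/
noncomputable def numSpanningTrees {V : Type*} (G : SimpleGraph V) : ℕ :=
  Nat.card {T : SimpleGraph V // T ≤ G ∧ T.IsTree}

end SimpleGraph

/-! Replace the zero Laplacian eigenvalue by `n * α`. The resulting family `y` is positive, and its
first two power sums follow from the traces of `L` and `L²`; they give `Ω = n ∑ y² - (∑ y)²`. Write
`μ₁ / μ_{n-1} = 1 + (μ₁ - μ_{n-1}) / μ_{n-1}`. The difference is controlled by the variance of `y`.
The reciprocal is the product of the other values over `∏ y`: AM-GM bounds the numerator, and `∏ y ≥
n α · n τ` bounds the denominator (`div_le_one_add_of_prod_ge`). The product bound needs only `τ ≤`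
each principal cofactor of `L`. Expanding the cofactor row by row gives a sum over choices of one
neighbour per non-root vertex; every term is 0 or 1, and distinct spanning trees yield distinct
terms equal to 1. -/

namespace Matrix

/-! ### Determinants of rooted functional digraphs -/

variable {V R : Type*} [DecidableEq V] [CommRing R]

/-- The matrix `1 - P`, where `P` is the adjacency matrix of the functional digraph of `f` with the
arc leaving the root `r` deleted. -/
def rootedLap (R : Type*) [CommRing R] (r : V) (f : V → V) : Matrix V V R :=
  of fun v => Pi.single v 1 - if v = r then 0 else Pi.single (f v) 1

theorem rootedLap_root (r : V) (f : V → V) : rootedLap R r f r = Pi.single r 1 := by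
  ext j
  simp [rootedLap]

theorem rootedLap_of_ne {r v : V} (hv : v ≠ r) (f : V → V) :
    rootedLap R r f v = Pi.single v 1 - Pi.single (f v) 1 := by
  ext j
  simp [rootedLap, hv]

theorem rootedLap_apply_of_imp_ne {r : V} {f : V → V} {i j : V} (h : i ≠ r → j ≠ f i) :
    rootedLap R r f i j = (1 : Matrix V V R) i j := by
  by_cases hi : i = r
  · subst hi
    rw [rootedLap_root, one_apply, Pi.single_apply, if_congr eq_comm rfl rfl]
  · rw [rootedLap_of_ne hi, one_apply, Pi.sub_apply, Pi.single_eq_of_ne (h hi), Pi.single_apply,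
      sub_zero, if_congr eq_comm rfl rfl]

variable [Fintype V]

/-- Arcs strictly decrease `d`, so grouping vertices by `d` makes the matrix block triangular with
identity diagonal blocks. -/
theorem det_rootedLap_of_lt {r : V} {f : V → V} (d : V → ℕ) (hd : ∀ v, v ≠ r → d (f v) < d v) :
    (rootedLap R r f).det = 1 := by
  have happ {i j : V} (hij : d i ≤ d j) : rootedLap R r f i j = (1 : Matrix V V R) i j :=
    rootedLap_apply_of_imp_ne fun hi h => (hd i hi).not_ge (h ▸ hij)
  have hM : (rootedLap R r f).BlockTriangular (OrderDual.toDual ∘ d) := by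
    intro i j hij
    have hij : d i < d j := hij
    rw [happ hij.le, one_apply_ne]
    rintro rfl
    exact lt_irrefl _ hij
  rw [hM.det]
  refine Finset.prod_eq_one fun a _ => ?_
  suffices h : (rootedLap R r f).toSquareBlock (OrderDual.toDual ∘ d) a = 1 by rw [h, det_one]
  ext ⟨i, hi⟩ ⟨j, hj⟩
  have hij : d i = d j := OrderDual.toDual.injective (hi.trans hj.symm)
  simp [toSquareBlock_def, happ hij.le, one_apply]

/-- The indicator of the vertices whose orbit avoids `r` is a nonzero kernel vector. -/
theorem det_rootedLap_eq_zero [IsDomain R] {r : V} {f : V → V} {v : V}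
    (hv : ∀ k, f^[k] v ≠ r) : (rootedLap R r f).det = 0 := by
  classical
  rw [← exists_mulVec_eq_zero_iff]
  let x : V → R := fun u => if ∀ k, f^[k] u ≠ r then 1 else 0
  refine ⟨x, fun h => ?_, ?_⟩
  · have := congrFun h v
    simp [x, hv] at this
  · ext u
    have hx : ((rootedLap R r f) *ᵥ x) u = x u - if u = r then 0 else x (f u) := by
      rw [mulVec]
      by_cases hu : u = r
      · subst hu
        simp [rootedLap_root]
      · rw [rootedLap_of_ne hu]
        change (Pi.single u 1 - Pi.single (f u) 1) ⬝ᵥ x = _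
        simp [sub_dotProduct, hu]
    rw [hx]
    by_cases hu : u = r
    · have : ¬ ∀ k, f^[k] u ≠ r := fun h => h 0 hu
      simp only [x, if_neg this, if_pos hu, sub_zero, Pi.zero_apply]
    · have : (∀ k, f^[k] u ≠ r) ↔ ∀ k, f^[k] (f u) ≠ r :=
        ⟨fun h k => h (k + 1), fun h k => by cases k with
          | zero => exact hu
          | succ k => exact h k⟩
      simp only [x, if_neg hu, this, sub_self, Pi.zero_apply]

theorem det_rootedLap_nonneg [LinearOrder R] [IsStrictOrderedRing R] (r : V) (f : V → V) :
    0 ≤ (rootedLap R r f).det := by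
  classical
  by_cases h : ∀ v, ∃ k, f^[k] v = r
  · refine (det_rootedLap_of_lt (R := R) (fun v => Nat.find (h v)) fun v hv => ?_).symm ▸ zero_le_one
    obtain ⟨k, hk⟩ : ∃ k, Nat.find (h v) = k + 1 :=
      Nat.exists_eq_succ_of_ne_zero fun h0 => hv ((Nat.find_eq_zero (h v)).1 h0)
    have hs := Nat.find_spec (h v)
    rw [hk] at hs
    rw [hk, Nat.lt_succ_iff]
    exact Nat.find_min' (h (f v)) hs
  · push Not at h
    obtain ⟨v, hv⟩ := h
    rw [det_rootedLap_eq_zero hv]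

end Matrix

/-! ### Spanning trees and cofactors of the Laplacian -/

namespace SimpleGraph

variable {V : Type*}

/-- `f` sends every vertex other than `r` to a neighbour which is nearer to `r`. -/
def IsParentFun (T : SimpleGraph V) (r : V) (f : V → V) : Prop :=
  f r = r ∧ ∀ v, v ≠ r → T.Adj v (f v) ∧ T.dist (f v) r < T.dist v r

theorem Connected.exists_isParentFun {T : SimpleGraph V} (hT : T.Connected) (r : V) :
    ∃ f, T.IsParentFun r f := by
  have h (v : V) : ∃ u, (v = r → u = r) ∧ (v ≠ r → T.Adj v u ∧ T.dist u r < T.dist v r) := by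
    by_cases hv : v = r
    · exact ⟨r, fun _ => rfl, fun h => absurd hv h⟩
    · obtain ⟨p, hp⟩ := (hT.preconnected v r).exists_walk_length_eq_dist
      cases p with
      | nil => exact absurd rfl hv
      | @cons _ u _ hadj q =>
        refine ⟨u, fun h => absurd h hv, fun _ => ⟨hadj, ?_⟩⟩
        rw [← hp, Walk.length_cons, Nat.lt_succ_iff]
        exact dist_le q
  choose f hf using h
  exact ⟨f, (hf r).1 rfl, fun v => (hf v).2⟩

/-- The parent edges lie in `T ⊓ T'` and already connect every vertex to `r`; a tree is minimal
among connected graphs. Applied both ways, this shows that a parent function determines its tree. -/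
theorem IsTree.le_of_isParentFun {T T' : SimpleGraph V} (hT : T.IsTree) {r : V} {f : V → V}
    (hf : T.IsParentFun r f) (hf' : T'.IsParentFun r f) : T ≤ T' := by
  have hreach : ∀ k v, T.dist v r = k → (T ⊓ T').Reachable v r := by
    intro k
    induction k using Nat.strong_induction_on with
    | _ k ih =>
      rintro v rfl
      by_cases hv : v = r
      · rw [hv]
      · have hadj : (T ⊓ T').Adj v (f v) := ⟨(hf.2 v hv).1, (hf'.2 v hv).1⟩
        exact hadj.reachable.trans (ih _ (hf.2 v hv).2 _ rfl)
  have hconn : (T ⊓ T').Connected :=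
    { preconnected := fun u v => (hreach _ u rfl).trans (hreach _ v rfl).symm
      nonempty := ⟨r⟩ }
  exact ((isTree_iff_minimal_connected.1 hT).2 hconn inf_le_left).trans inf_le_right

theorem Connected.numSpanningTrees_pos [Finite V] {G : SimpleGraph V} (hG : G.Connected) :
    0 < G.numSpanningTrees := by
  obtain ⟨T, hT, hT'⟩ := hG.exists_isTree_le
  have : Nonempty {T : SimpleGraph V // T ≤ G ∧ T.IsTree} := ⟨⟨T, hT, hT'⟩⟩
  exact Nat.card_pos

variable [Fintype V] [DecidableEq V] (G : SimpleGraph V) [DecidableRel G.Adj]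

theorem adjugate_lapMatrix_apply_self (R : Type*) [CommRing R] (r : V) :
    (G.lapMatrix R).adjugate r r =
      ∑ f ∈ Fintype.piFinset fun v => if v = r then {r} else G.neighborFinset v,
        (Matrix.rootedLap R r f).det := by
  -- The singleton choice at `r` produces the unit row that the adjugate entry substitutes there.
  have h := (Matrix.detRowAlternating (n := V) (R := R)).toMultilinearMap.map_sum_finset
    (fun v j => (Pi.single v 1 - if v = r then 0 else Pi.single j 1 : V → R))
    (fun v => if v = r then {r} else G.neighborFinset v)
  rw [Matrix.adjugate_apply]
  refine Eq.trans ?_ h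
  change Matrix.det _ = Matrix.det _
  congr 1
  ext v w
  by_cases hv : v = r
  · subst hv
    simp
  · simp only [Matrix.updateRow_ne hv, if_neg hv, Finset.sum_sub_distrib, Finset.sum_const,
      card_neighborFinset_eq_degree, Pi.sub_apply, Finset.sum_apply]
    simp [lapMatrix, degMatrix, Matrix.diagonal_apply, Pi.single_apply, adjMatrix_apply, eq_comm]

/-- One half of the matrix tree theorem. -/
theorem numSpanningTrees_le_adjugate (r : V) :
    (G.numSpanningTrees : ℝ) ≤ (G.lapMatrix ℝ).adjugate r r := by
  classical
  rw [adjugate_lapMatrix_apply_self]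
  choose F hF using fun T : {T : SimpleGraph V // T ≤ G ∧ T.IsTree} =>
    T.2.2.connected.exists_isParentFun r
  have hinj : Function.Injective F := by
    intro T T' h
    have hT' := hF T'
    rw [← h] at hT'
    exact Subtype.ext (le_antisymm (T.2.2.le_of_isParentFun (hF T) hT')
      (T'.2.2.le_of_isParentFun hT' (hF T)))
  calc (G.numSpanningTrees : ℝ)
      = ∑ f ∈ Finset.univ.image F, (Matrix.rootedLap ℝ r f).det := by
        rw [Finset.sum_image hinj.injOn, numSpanningTrees, Nat.card_eq_fintype_card,
          Finset.sum_congr rfl fun T _ =>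
            Matrix.det_rootedLap_of_lt (fun v => T.1.dist v r) fun v hv => ((hF T).2 v hv).2]
        simp
    _ ≤ _ := by
        refine Finset.sum_le_sum_of_subset_of_nonneg (fun f hf => ?_)
          fun f _ _ => Matrix.det_rootedLap_nonneg r f
        obtain ⟨T, -, rfl⟩ := Finset.mem_image.1 hf
        refine Fintype.mem_piFinset.2 fun v => ?_
        by_cases hv : v = r
        · simp [hv, (hF T).1]
        · simpa [hv] using T.2.1 ((hF T).2 v hv).1

end SimpleGraph

/-! ### Spectral traces -/

namespace Matrix.IsHermitian

theorem trace_adjugate {V : Type*} [Fintype V] [DecidableEq V] {A : Matrix V V ℝ}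
    (hA : A.IsHermitian) :
    A.adjugate.trace = ∑ i, ∏ j ∈ Finset.univ.erase i, hA.eigenvalues j := by
  conv_lhs => rw [hA.spectral_theorem, Unitary.conjStarAlgAut_apply, adjugate_mul_distrib,
    trace_mul_comm, adjugate_mul_distrib, mul_assoc, ← adjugate_mul_distrib]
  simp [adjugate_diagonal, trace]

theorem trace_mul_self {V : Type*} [Fintype V] [DecidableEq V] {A : Matrix V V ℝ}
    (hA : A.IsHermitian) :
    (A * A).trace = ∑ i, hA.eigenvalues i ^ 2 := by
  conv_lhs => rw [hA.spectral_theorem, ← map_mul, Unitary.conjStarAlgAut_apply,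
    trace_mul_comm, ← mul_assoc]
  simp [trace, sq]

end Matrix.IsHermitian

namespace SimpleGraph
variable {V : Type*} [Fintype V] [DecidableEq V] (G : SimpleGraph V) [DecidableRel G.Adj]

theorem trace_lapMatrix : (G.lapMatrix ℝ).trace = 2 * (G.edgeFinset.card : ℝ) := by
  have := G.sum_degrees_eq_twice_card_edges
  rw [lapMatrix, Matrix.trace_sub, trace_adjMatrix, sub_zero, degMatrix, Matrix.trace_diagonal]
  exact_mod_cast this

theorem trace_lapMatrix_mul_self :
    (G.lapMatrix ℝ * G.lapMatrix ℝ).trace = G.firstZagreb + 2 * (G.edgeFinset.card : ℝ) := by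
  have h : ∑ v, (G.degree v : ℝ) = 2 * (G.edgeFinset.card : ℝ) := by
    exact_mod_cast G.sum_degrees_eq_twice_card_edges
  have h1 : (G.degMatrix ℝ * G.adjMatrix ℝ).trace = 0 := by
    simp [Matrix.trace, degMatrix, Matrix.diagonal_mul, -mul_adjMatrix_apply]
  have h2 : (G.adjMatrix ℝ * G.adjMatrix ℝ).trace = ∑ v, (G.degree v : ℝ) :=
    Finset.sum_congr rfl fun v _ => G.adjMatrix_mul_self_apply_self v
  rw [lapMatrix, sub_mul, mul_sub, mul_sub, Matrix.trace_sub, Matrix.trace_sub, Matrix.trace_sub,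
    Matrix.trace_mul_comm (G.adjMatrix ℝ) (G.degMatrix ℝ), h1, h2, h]
  simp [degMatrix, Matrix.trace, firstZagreb, sq]

end SimpleGraph

/-! ### Inequalities for finite real families -/

section Real

theorem prod_le_pow_mean {ι : Type*} (s : Finset ι) (y : ι → ℝ) (hy : ∀ i ∈ s, 0 ≤ y i) :
    ∏ i ∈ s, y i ≤ ((∑ i ∈ s, y i) / s.card) ^ s.card := by
  rcases s.eq_empty_or_nonempty with rfl | hs
  · simp
  have hc : 0 < s.card := hs.card_pos
  have h := Real.geom_mean_le_arith_mean s (fun _ => 1) y (fun _ _ => zero_le_one)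
    (by simpa using hc) hy
  simp only [Real.rpow_one, Finset.sum_const, nsmul_eq_mul, mul_one, one_mul] at h
  have hp : 0 ≤ ∏ i ∈ s, y i := Finset.prod_nonneg hy
  calc ∏ i ∈ s, y i = ((∏ i ∈ s, y i) ^ ((s.card : ℝ)⁻¹)) ^ s.card :=
        (Real.rpow_inv_natCast_pow hp hc.ne').symm
    _ ≤ _ := pow_le_pow_left₀ (by positivity) h _

variable {ι : Type*} [Fintype ι] [DecidableEq ι]

/-- The difference of two values of `y` is at most `√(2 (∑ y² - (∑ y)² / n))`. -/
theorem sub_le_sqrt_two_mul_variance (y : ι → ℝ) (i j : ι) :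
    y i - y j ≤ Real.sqrt (2 * (Fintype.card ι * ∑ k, y k ^ 2 - (∑ k, y k) ^ 2) /
      Fintype.card ι) := by
  have hn : (0 : ℝ) < Fintype.card ι := by exact_mod_cast Fintype.card_pos_iff.2 ⟨i⟩
  apply Real.le_sqrt_of_sq_le
  set n := (Fintype.card ι : ℝ)
  set c : ℝ := (∑ k, y k) / n with hc
  have hS : ∑ k, y k = n * c := by rw [hc]; field_simp
  have hvar : ∑ k, (y k - c) ^ 2 = ∑ k, y k ^ 2 - n * c ^ 2 := by
    simp only [sub_sq, Finset.sum_add_distrib, Finset.sum_sub_distrib, ← Finset.sum_mul,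
      ← Finset.mul_sum, hS, Finset.sum_const, Finset.card_univ, nsmul_eq_mul]
    ring
  have hrhs : 2 * (n * ∑ k, y k ^ 2 - (∑ k, y k) ^ 2) / n = 2 * ∑ k, (y k - c) ^ 2 := by
    rw [hvar, hS]; field_simp
  rw [hrhs]
  -- Equality must be allowed: for `n = 2`, `μ₁` and `μ_{n-1}` have the same index.
  by_cases hij : i = j
  · rw [hij, sub_self, zero_pow two_ne_zero]; positivity
  · have : ∑ k ∈ {i, j}, (y k - c) ^ 2 ≤ ∑ k, (y k - c) ^ 2 :=
      Finset.sum_le_sum_of_subset_of_nonneg (Finset.subset_univ _) fun _ _ _ => sq_nonneg _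
    rw [Finset.sum_pair hij] at this
    nlinarith [sq_nonneg (y i - c + (y j - c))]

/-- The mean of all values of `y` but one is at most `(∑ y + √(Ω / (n - 1))) / n`. -/
theorem sum_erase_div_le (y : ι → ℝ) (j : ι) (hn : 2 ≤ Fintype.card ι) :
    (∑ k ∈ Finset.univ.erase j, y k) / ((Fintype.card ι : ℝ) - 1) ≤
      (∑ k, y k + Real.sqrt ((Fintype.card ι * ∑ k, y k ^ 2 - (∑ k, y k) ^ 2) /
        ((Fintype.card ι : ℝ) - 1))) / Fintype.card ι := by
  have hn' : (2 : ℝ) ≤ Fintype.card ι := by exact_mod_cast hn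
  have hcs := sq_sum_le_card_mul_sum_sq (s := Finset.univ.erase j) (f := y)
  rw [Finset.card_erase_of_mem (Finset.mem_univ j), Finset.card_univ,
    Nat.cast_sub (by omega), Nat.cast_one] at hcs
  rw [← Finset.add_sum_erase _ y (Finset.mem_univ j),
    ← Finset.add_sum_erase _ (fun k => y k ^ 2) (Finset.mem_univ j)]
  set n := (Fintype.card ι : ℝ)
  set s := ∑ k ∈ Finset.univ.erase j, y k
  set q := ∑ k ∈ Finset.univ.erase j, y k ^ 2
  have h1 : 0 < n - 1 := by linarith
  -- Equivalent to the goal, since `n * (s / (n - 1)) = s + s / (n - 1)`; it follows from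
  -- Cauchy–Schwarz on the other `n - 1` values.
  have hle : s / (n - 1) - y j ≤ Real.sqrt ((n * (y j ^ 2 + q) - (y j + s) ^ 2) / (n - 1)) := by
    apply Real.le_sqrt_of_sq_le
    rw [le_div_iff₀ h1]
    have hq : n / (n - 1) * s ^ 2 ≤ n * q := by
      rw [div_mul_eq_mul_div, div_le_iff₀ h1]
      nlinarith
    have : (s / (n - 1) - y j) ^ 2 * (n - 1) =
        n / (n - 1) * s ^ 2 - s ^ 2 - 2 * s * y j + (n - 1) * y j ^ 2 := by
      field_simp; ring
    nlinarith
  rw [le_div_iff₀ (by linarith)]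
  have : s / (n - 1) * n = s + s / (n - 1) := by field_simp; ring
  linarith

/-- Bound on the ratio of two values of a positive family in terms of the first two power sums and
a lower bound `P` for the product. -/
theorem div_le_one_add_of_prod_ge (y : ι → ℝ) (hy : ∀ i, 0 < y i) (hn : 2 ≤ Fintype.card ι)
    (i j : ι) {P : ℝ} (hP : 0 < P) (hPy : P ≤ ∏ k, y k) :
    y i / y j ≤ 1 + Real.sqrt (2 * (Fintype.card ι * ∑ k, y k ^ 2 - (∑ k, y k) ^ 2) /
      Fintype.card ι) * ((∑ k, y k + Real.sqrt ((Fintype.card ι * ∑ k, y k ^ 2 - (∑ k, y k) ^ 2) /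
        ((Fintype.card ι : ℝ) - 1))) / Fintype.card ι) ^ (Fintype.card ι - 1) / P := by
  have hcard : (Finset.univ.erase j).card = Fintype.card ι - 1 := by
    rw [Finset.card_erase_of_mem (Finset.mem_univ j), Finset.card_univ]
  have hcast : ((Fintype.card ι - 1 : ℕ) : ℝ) = (Fintype.card ι : ℝ) - 1 := by
    rw [Nat.cast_sub (by omega), Nat.cast_one]
  have hn' : (2 : ℝ) ≤ Fintype.card ι := by exact_mod_cast hn
  have hamgm := prod_le_pow_mean (Finset.univ.erase j) y fun k _ => (hy k).le
  rw [hcard, hcast] at hamgm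
  have hB := hamgm.trans (pow_le_pow_left₀
    (div_nonneg (Finset.sum_nonneg fun k _ => (hy k).le) (by linarith))
    (sum_erase_div_le y j hn) _)
  have hinv : 1 / y j ≤ (∏ k ∈ Finset.univ.erase j, y k) / P := by
    rw [div_le_div_iff₀ (hy j) hP, one_mul, mul_comm, Finset.mul_prod_erase _ y (Finset.mem_univ j)]
    exact hPy
  have hratio : y i / y j = 1 + (y i - y j) * (1 / y j) := by
    have := (hy j).ne'
    field_simp; ring
  rw [hratio, mul_div_assoc]
  exact add_le_add_right (mul_le_mul (sub_le_sqrt_two_mul_variance y i j)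
    (hinv.trans (div_le_div_of_nonneg_right hB hP.le)) (one_div_pos.2 (hy j)).le
    (Real.sqrt_nonneg _)) _

end Real

/-! ### Laplacian spectrum and the final bound -/

namespace SimpleGraph

theorem lapEigenvalue_eq_eigenvalues {V : Type*} [Fintype V] [DecidableEq V] (G : SimpleGraph V)
    [DecidableRel G.Adj] {k : ℕ} (h1 : 1 ≤ k) (h2 : k ≤ Fintype.card V) :
    G.lapEigenvalue k = (G.isHermitian_lapMatrix (R := ℝ)).eigenvalues
      (Fintype.equivOfCardEq (Fintype.card_fin _) ⟨k - 1, by omega⟩) := by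
  rw [lapEigenvalue, dif_pos ⟨h1, h2⟩, Matrix.IsHermitian.eigenvalues, Equiv.symm_apply_apply]

/-- The determinant vanishes, so some eigenvalue is 0; the last one is no larger, and is nonnegative
by semidefiniteness. -/
theorem eigenvalues_lapMatrix_last_eq_zero {V : Type*} [Fintype V] [DecidableEq V] [Nonempty V]
    (G : SimpleGraph V) [DecidableRel G.Adj] :
    (G.isHermitian_lapMatrix (R := ℝ)).eigenvalues (Fintype.equivOfCardEq (Fintype.card_fin _)
      ⟨Fintype.card V - 1, Nat.sub_lt Fintype.card_pos one_pos⟩) = 0 := by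
  have hA := G.isHermitian_lapMatrix (R := ℝ)
  have h := G.det_lapMatrix_eq_zero
  rw [hA.det_eq_prod_eigenvalues, Finset.prod_eq_zero_iff] at h
  obtain ⟨k, -, hk⟩ := h
  refine le_antisymm ?_ ((posSemidef_lapMatrix ℝ G).eigenvalues_nonneg _)
  rw [← (show hA.eigenvalues k = 0 from hk), Matrix.IsHermitian.eigenvalues,
    Matrix.IsHermitian.eigenvalues, Equiv.symm_apply_apply]
  refine hA.eigenvalues₀_antitone (Fin.le_def.2 ?_)
  have := ((Fintype.equivOfCardEq (Fintype.card_fin (Fintype.card V))).symm k).2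
  simp only
  omega

/-- The product of all Laplacian eigenvalues but one zero eigenvalue is at least `n τ`. -/
theorem card_mul_numSpanningTrees_le {V : Type*} [Fintype V] [DecidableEq V] (G : SimpleGraph V)
    [DecidableRel G.Adj] {i₀ : V} (h₀ : (G.isHermitian_lapMatrix (R := ℝ)).eigenvalues i₀ = 0) :
    (Fintype.card V : ℝ) * G.numSpanningTrees ≤
      ∏ j ∈ Finset.univ.erase i₀, (G.isHermitian_lapMatrix (R := ℝ)).eigenvalues j := by
  have h : (G.lapMatrix ℝ).adjugate.trace =
      ∏ j ∈ Finset.univ.erase i₀, (G.isHermitian_lapMatrix (R := ℝ)).eigenvalues j := by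
    -- Every summand that omits an index other than `i₀` retains the zero factor at `i₀`.
    rw [(G.isHermitian_lapMatrix (R := ℝ)).trace_adjugate]
    refine Finset.sum_eq_single i₀ (fun i _ hi => ?_) fun h => absurd (Finset.mem_univ _) h
    exact Finset.prod_eq_zero (Finset.mem_erase.2 ⟨hi.symm, Finset.mem_univ _⟩) h₀
  rw [← h, Matrix.trace]
  calc (Fintype.card V : ℝ) * G.numSpanningTrees = ∑ _r : V, (G.numSpanningTrees : ℝ) := by simp
    _ ≤ _ := Finset.sum_le_sum fun r _ => G.numSpanningTrees_le_adjugate r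

end SimpleGraph

theorem theorem3p3 {V : Type*} [Fintype V] [DecidableEq V] (G : SimpleGraph V)
    [DecidableRel G.Adj] (hG : G.Connected)
    (n m τ Z₁ : ℕ) (hn : n = Fintype.card V) (hn2 : 2 ≤ n) (hm : m = G.edgeFinset.card)
    (hτ : τ = G.numSpanningTrees) (hZ : Z₁ = G.firstZagreb)
    (α : ℝ) (hα₁ : G.lapEigenvalue (n - 1) ≤ n * α) (hα₂ : n * α ≤ G.lapEigenvalue 1)
    (Ω : ℝ)
    (hΩ : Ω = (n : ℝ) ^ 2 * ((n : ℝ) - 1) * α ^ 2 - 4 * m * n * α + n * Z₁ + 2 * m * n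
      - 4 * (m : ℝ) ^ 2) :
    G.lapSpectralRatio ≤
      1 + Real.sqrt (2 * Ω) * (2 * m + n * α + Real.sqrt (Ω / ((n : ℝ) - 1))) ^ (n - 1) /
        ((n : ℝ) ^ ((n : ℝ) + 3 / 2) * α * τ) := by
  have hne : Nonempty V := hG.nonempty
  have hA := G.isHermitian_lapMatrix (R := ℝ)
  set e : Fin (Fintype.card V) ≃ V := Fintype.equivOfCardEq (Fintype.card_fin _) with he
  set i₀ := e ⟨Fintype.card V - 1, by omega⟩ with hi₀
  set i₁ := e ⟨1 - 1, by omega⟩ with hi₁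
  set i₂ := e ⟨Fintype.card V - 1 - 1, by omega⟩ with hi₂
  have h₁₀ : i₁ ≠ i₀ := e.injective.ne (by simp only [ne_eq, Fin.mk.injEq]; omega)
  have h₂₀ : i₂ ≠ i₀ := e.injective.ne (by simp only [ne_eq, Fin.mk.injEq]; omega)
  have hμ₀ : hA.eigenvalues i₀ = 0 := G.eigenvalues_lapMatrix_last_eq_zero
  have hμ₁ : G.lapEigenvalue 1 = hA.eigenvalues i₁ :=
    G.lapEigenvalue_eq_eigenvalues le_rfl (by omega)
  have hμ₂ : G.lapEigenvalue (Fintype.card V - 1) = hA.eigenvalues i₂ :=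
    G.lapEigenvalue_eq_eigenvalues (by omega) (by omega)
  have hτ0 : (0 : ℝ) < τ := by rw [hτ]; exact_mod_cast hG.numSpanningTrees_pos
  have hn0 : (0 : ℝ) < n := by exact_mod_cast (by omega : 0 < n)
  have hprod := G.card_mul_numSpanningTrees_le hμ₀
  rw [← hn, ← hτ] at hprod
  -- A second zero eigenvalue would make the product 0, against `n τ > 0`.
  have hpos : ∀ i, i ≠ i₀ → 0 < hA.eigenvalues i := fun i hi =>
    lt_of_le_of_ne ((SimpleGraph.posSemidef_lapMatrix ℝ G).eigenvalues_nonneg i) fun h =>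
      ((mul_pos hn0 hτ0).trans_le hprod).ne'
        (Finset.prod_eq_zero (Finset.mem_erase.2 ⟨hi, Finset.mem_univ i⟩) h.symm)
  have hnα : 0 < n * α := by
    rw [hn, hμ₂, ← hn] at hα₁
    exact (hpos i₂ h₂₀).trans_le hα₁
  have hα : 0 < α := pos_of_mul_pos_right hnα hn0.le
  set y : V → ℝ := Function.update hA.eigenvalues i₀ (n * α) with hy
  have hy₀ : y i₀ = n * α := Function.update_self ..
  have hy' : ∀ i, i ≠ i₀ → y i = hA.eigenvalues i := fun i hi => Function.update_of_ne hi ..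
  have hypos : ∀ i, 0 < y i := fun i => by
    by_cases hi : i = i₀
    · rwa [hi, hy₀]
    · rw [hy' i hi]; exact hpos i hi
  have hsum : ∑ i, y i = 2 * m + n * α := by
    have h := hA.trace_eq_sum_eigenvalues
    rw [G.trace_lapMatrix, ← hm, ← Finset.add_sum_erase _ _ (Finset.mem_univ i₀), hμ₀] at h
    rw [← Finset.add_sum_erase _ _ (Finset.mem_univ i₀), hy₀,
      Finset.sum_congr rfl fun i hi => hy' i (Finset.ne_of_mem_erase hi), h]
    simp [add_comm]
  have hsq : ∑ i, y i ^ 2 = Z₁ + 2 * m + (n * α) ^ 2 := by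
    have h := hA.trace_mul_self
    rw [G.trace_lapMatrix_mul_self, ← hm, ← hZ,
      ← Finset.add_sum_erase _ _ (Finset.mem_univ i₀), hμ₀] at h
    rw [← Finset.add_sum_erase _ _ (Finset.mem_univ i₀), hy₀,
      Finset.sum_congr rfl fun i hi => by rw [hy' i (Finset.ne_of_mem_erase hi)], h]
    ring
  have hP : n * α * (n * τ) ≤ ∏ i, y i := by
    rw [← Finset.mul_prod_erase _ _ (Finset.mem_univ i₀), hy₀,
      Finset.prod_congr rfl fun i hi => hy' i (Finset.ne_of_mem_erase hi)]
    exact mul_le_mul_of_nonneg_left hprod hnα.le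
  have key := div_le_one_add_of_prod_ge y hypos (hn ▸ hn2) i₁ i₂ (by positivity) hP
  have hΩ' : (n : ℝ) * ∑ i, y i ^ 2 - (∑ i, y i) ^ 2 = Ω := by
    rw [hsum, hsq, hΩ]; ring
  rw [← hn, hΩ', hsum, hy' i₁ h₁₀, hy' i₂ h₂₀, ← hμ₁, ← hμ₂] at key
  refine key.trans_eq ?_
  -- The factors come from `√(2Ω/n)`, from the mean raised to the power `n - 1`, and from `n α · n
  -- τ`.
  have hpow : (n : ℝ) ^ ((n : ℝ) + 3 / 2) = Real.sqrt n * n ^ (n - 1) * n ^ 2 := by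
    rw [Real.sqrt_eq_rpow, ← Real.rpow_natCast, ← Real.rpow_natCast, ← Real.rpow_add hn0,
      ← Real.rpow_add hn0, Nat.cast_sub (by omega)]
    congr 1
    push_cast
    ring
  rw [hpow, Real.sqrt_div' _ hn0.le, div_pow]
  have hs : 0 < Real.sqrt n := Real.sqrt_pos.2 hn0
  field_simp
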